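/- Let $(a_k)_{k\ge 1}$ be a sequence of complex numbers with $\sum_{k=1}^{\infty}|a_k|<\infty$, and let $$V(x)=\sum_{k=1}^{\infty}a_k e^{ikx},\qquad x\in\mathbb R,$$ a bounded, continuous, complex-valued function of period $2\pi$. Let $H$ be the associated Hill operator in $L^2(\mathbb R)$, that is, $Hf=-f''+Vf$ with domain the Sobolev space $W^{2,2}(\mathbb R)$. Then the spectrum of $H$ is purely continuous and equals $[0,\infty)$. Here the spectrum $\sigma(H)$ is the set of those $z\in\mathbb C$ for which $H-z$ has no everywhere defined bounded inverse, and purely continuous means that for every $z\in\sigma(H)$ the operator $H-z$ is injective and has dense range (so there is neither point spectrum nor residual spectrum). -/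

import Mathlib

open MeasureTheory
open scoped ContDiff BoundedContinuousFunction

namespace Hill

/-- The complex Hilbert space `L²(ℝ)` (Lebesgue measure). -/
abbrev L2 : Type := Lp ℂ 2 (volume : Measure ℝ)

/-- `g ∈ L²(ℝ)` is the weak derivative of `f ∈ L²(ℝ)`:
`∫ φ' f = - ∫ φ g` for every test function `φ ∈ C_c^∞(ℝ)`. -/
def IsWeakDeriv (f g : L2) : Prop :=
  ∀ φ : ℝ → ℝ, ContDiff ℝ ∞ φ → HasCompactSupport φ →
    ∫ x, deriv φ x • f x = -∫ x, φ x • g x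

theorem integrable_smul (f : L2) {φ : ℝ → ℝ} (hc : Continuous φ) (hs : HasCompactSupport φ) :
    Integrable (fun x => φ x • f x) :=
  ((Lp.memLp f).locallyIntegrable (by norm_num)).integrable_smul_left_of_hasCompactSupport hc hs

theorem IsWeakDeriv.add {f g f' g' : L2} (h : IsWeakDeriv f g) (h' : IsWeakDeriv f' g') :
    IsWeakDeriv (f + f') (g + g') := by
  intro φ hφ hs
  have hd : Continuous (deriv φ) := hφ.continuous_deriv (by simp)
  have e1 : ∫ x, deriv φ x • (f + f') x = ∫ x, (deriv φ x • f x + deriv φ x • f' x) := by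
    refine integral_congr_ae ?_
    filter_upwards [Lp.coeFn_add f f'] with x hx
    rw [hx, Pi.add_apply, smul_add]
  have e2 : ∫ x, φ x • (g + g') x = ∫ x, (φ x • g x + φ x • g' x) := by
    refine integral_congr_ae ?_
    filter_upwards [Lp.coeFn_add g g'] with x hx
    rw [hx, Pi.add_apply, smul_add]
  rw [e1, e2, integral_add (integrable_smul f hd hs.deriv) (integrable_smul f' hd hs.deriv),
    integral_add (integrable_smul g hφ.continuous hs) (integrable_smul g' hφ.continuous hs),
    h φ hφ hs, h' φ hφ hs, neg_add]

theorem IsWeakDeriv.smul {f g : L2} (c : ℂ) (h : IsWeakDeriv f g) :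
    IsWeakDeriv (c • f) (c • g) := by
  intro φ hφ hs
  have e1 : ∫ x, deriv φ x • (c • f) x = ∫ x, c • (deriv φ x • f x) := by
    refine integral_congr_ae ?_
    filter_upwards [Lp.coeFn_smul c f] with x hx
    rw [hx, Pi.smul_apply, smul_comm]
  have e2 : ∫ x, φ x • (c • g) x = ∫ x, c • (φ x • g x) := by
    refine integral_congr_ae ?_
    filter_upwards [Lp.coeFn_smul c g] with x hx
    rw [hx, Pi.smul_apply, smul_comm]
  rw [e1, e2, integral_smul, integral_smul, h φ hφ hs, smul_neg]

theorem IsWeakDeriv.zero : IsWeakDeriv 0 0 := by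
  simpa using IsWeakDeriv.smul (f := 0) (g := 0) 0 (fun φ _ _ => by
    have e : ∀ ψ : ℝ → ℝ, ∫ x, ψ x • (0 : L2) x = 0 := fun ψ => by
      refine (integral_congr_ae ?_).trans (integral_zero ℝ ℂ)
      filter_upwards [Lp.coeFn_zero ℂ 2 (volume : Measure ℝ)] with x hx
      rw [hx, Pi.zero_apply, smul_zero]
    rw [e, e, neg_zero])

/-- Weak derivatives are unique. -/
theorem IsWeakDeriv.unique {f g g' : L2} (h : IsWeakDeriv f g) (h' : IsWeakDeriv f g') :
    g = g' := by
  refine Lp.ext (ae_eq_of_integral_contDiff_smul_eq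
    ((Lp.memLp g).locallyIntegrable (by norm_num))
    ((Lp.memLp g').locallyIntegrable (by norm_num)) fun φ hφ hs => ?_)
  exact neg_injective ((h φ hφ hs).symm.trans (h' φ hφ hs))

/-- The Sobolev space `W^{2,2}(ℝ)`: those `f ∈ L²(ℝ)` whose weak derivatives `f'` and `f''` exist
and lie in `L²(ℝ)`. -/
def W22 : Submodule ℂ L2 where
  carrier := {f | ∃ f₁ f₂ : L2, IsWeakDeriv f f₁ ∧ IsWeakDeriv f₁ f₂}
  add_mem' := by
    rintro f g ⟨f₁, f₂, h₁, h₂⟩ ⟨g₁, g₂, k₁, k₂⟩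
    exact ⟨f₁ + g₁, f₂ + g₂, h₁.add k₁, h₂.add k₂⟩
  zero_mem' := ⟨0, 0, IsWeakDeriv.zero, IsWeakDeriv.zero⟩
  smul_mem' := by
    rintro c f ⟨f₁, f₂, h₁, h₂⟩
    exact ⟨c • f₁, c • f₂, h₁.smul c, h₂.smul c⟩

theorem exists_secondDeriv (f : W22) :
    ∃ f₂ : L2, ∃ f₁ : L2, IsWeakDeriv f f₁ ∧ IsWeakDeriv f₁ f₂ := by
  obtain ⟨f₁, f₂, h⟩ := f.2
  exact ⟨f₂, f₁, h⟩

theorem secondDeriv_unique {f f₁ f₂ g₁ g₂ : L2} (h₁ : IsWeakDeriv f f₁) (h₂ : IsWeakDeriv f₁ f₂)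
    (k₁ : IsWeakDeriv f g₁) (k₂ : IsWeakDeriv g₁ g₂) : f₂ = g₂ := by
  obtain rfl := h₁.unique k₁
  exact h₂.unique k₂

/-- The second weak derivative `f ↦ f''` as a linear map `W^{2,2}(ℝ) → L²(ℝ)`. -/
noncomputable def secondDeriv : W22 →ₗ[ℂ] L2 where
  toFun f := (exists_secondDeriv f).choose
  map_add' f g := by
    obtain ⟨u, h₁, h₂⟩ := (exists_secondDeriv f).choose_spec
    obtain ⟨v, k₁, k₂⟩ := (exists_secondDeriv g).choose_spec
    obtain ⟨w, l₁, l₂⟩ := (exists_secondDeriv (f + g)).choose_spec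
    exact secondDeriv_unique l₁ l₂ (h₁.add k₁) (h₂.add k₂)
  map_smul' c f := by
    obtain ⟨u, h₁, h₂⟩ := (exists_secondDeriv f).choose_spec
    obtain ⟨w, l₁, l₂⟩ := (exists_secondDeriv (c • f)).choose_spec
    exact secondDeriv_unique l₁ l₂ (h₁.smul c) (h₂.smul c)

theorem memLp_mul (V : ℝ →ᵇ ℂ) (f : L2) :
    MemLp (fun x => V x * f x) 2 (volume : Measure ℝ) :=
  (Lp.memLp f).of_le_mul (c := ‖V‖)
    (V.continuous.aestronglyMeasurable.mul (Lp.aestronglyMeasurable f))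
    (Filter.Eventually.of_forall fun x => by
      rw [norm_mul]
      exact mul_le_mul_of_nonneg_right (V.norm_coe_le_norm x) (norm_nonneg _))

/-- Multiplication by a bounded continuous function `V`, as a linear map of `L²(ℝ)`. -/
noncomputable def mulOp (V : ℝ →ᵇ ℂ) : L2 →ₗ[ℂ] L2 where
  toFun f := (memLp_mul V f).toLp
  map_add' f g := by
    rw [← MemLp.toLp_add]
    refine MemLp.toLp_congr _ _ ?_
    filter_upwards [Lp.coeFn_add f g] with x hx
    rw [hx, Pi.add_apply, Pi.add_apply, mul_add]
  map_smul' c f := by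
    rw [RingHom.id_apply, ← MemLp.toLp_const_smul]
    refine MemLp.toLp_congr _ _ ?_
    filter_upwards [Lp.coeFn_smul c f] with x hx
    simp [hx, mul_left_comm]

/-- The Schrödinger operator `H f = -f'' + V f` in `L²(ℝ)`, with domain `W^{2,2}(ℝ)`; it is called
the Hill operator when `V` is periodic. -/
noncomputable def hillOperator (V : ℝ →ᵇ ℂ) : L2 →ₗ.[ℂ] L2 where
  domain := W22
  toFun := -secondDeriv + (mulOp V).comp W22.subtype

section Spectrum

variable {E : Type*} [NormedAddCommGroup E] [NormedSpace ℂ E]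

/-- The resolvent set of an unbounded operator `T` in `E`: those `z` for which
`T - z : dom T → E` has an everywhere defined bounded two-sided inverse `R`. -/
def resolventSet (T : E →ₗ.[ℂ] E) : Set ℂ :=
  {z | ∃ R : E →L[ℂ] E,
    (∀ g : E, ∃ h : R g ∈ T.domain, T ⟨R g, h⟩ - z • R g = g) ∧
    ∀ f : T.domain, R (T f - z • (f : E)) = f}

/-- The spectrum of an unbounded operator: the complement of the resolvent set. -/
def spectrum (T : E →ₗ.[ℂ] E) : Set ℂ := (resolventSet T)ᶜ

/-- The continuous spectrum of an unbounded operator: those points `z` of the spectrum for which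
`T - z` is injective and has dense range. The rest of the spectrum consists of the point spectrum
(`T - z` not injective) and of the residual spectrum (`T - z` injective, range not dense). -/
def continuousSpectrum (T : E →ₗ.[ℂ] E) : Set ℂ :=
  {z ∈ spectrum T | Function.Injective (fun f : T.domain => T f - z • (f : E)) ∧
    DenseRange (fun f : T.domain => T f - z • (f : E))}

/-- The spectrum of `T` is purely continuous: there is no point spectrum and no residual
spectrum. -/
def HasPurelyContinuousSpectrum (T : E →ₗ.[ℂ] E) : Prop := continuousSpectrum T = spectrum T

end Spectrum

theorem norm_term (a : ℕ+ → ℂ) (k : ℕ+) (x : ℝ) :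
    ‖a k * Complex.exp (Complex.I * (k : ℂ) * (x : ℂ))‖ = ‖a k‖ := by
  have : Complex.I * (k : ℂ) * (x : ℂ) = (((k : ℝ) * x : ℝ) : ℂ) * Complex.I := by
    push_cast; ring
  rw [norm_mul, this, Complex.norm_exp_ofReal_mul_I, mul_one]

/-- The potential `V(x) = ∑_{k ≥ 1} a_k e^{ikx}` of a summable sequence `(a_k)_{k ≥ 1}`; it is
bounded and continuous because the series converges absolutely and uniformly. -/
noncomputable def potential (a : ℕ+ → ℂ) (ha : Summable fun k => ‖a k‖) : ℝ →ᵇ ℂ :=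
  BoundedContinuousFunction.ofNormedAddCommGroup
    (fun x : ℝ => ∑' k : ℕ+, a k * Complex.exp (Complex.I * (k : ℂ) * (x : ℂ)))
    (continuous_tsum (fun k => by fun_prop) ha fun k x => (norm_term a k x).le)
    (∑' k : ℕ+, ‖a k‖)
    (fun x => tsum_of_norm_bounded ha.hasSum fun k => (norm_term a k x).le)

end Hill

/-!
Conjugation with the Fourier transform turns `H - z` into the operator
`f ↦ ((2πξ)² - z) f(ξ) + ∑_{k ≥ 1} a_k f(ξ - kc)` with `c = 1/2π` (`fourier_hillOperator_sub`),
because `e^{ikx}` becomes the translation by `kc` (`fourier_mulCLM_expBCF`). All frequencies of the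
potential are positive, so on each chain `ξ + ℤc` this operator is triangular, with the same
diagonal `(2πξ)² - z` as the operator with zero potential; the spectrum is decided by the diagonal.

* For almost every `ξ` the diagonal has no zero on the chain of `ξ`. It tends to infinity along the
  chain, so a homogeneous equation has no bounded solution besides zero (`eq_zero_of_triangular`),
  and square integrable functions are bounded on almost every chain (`ae_bounded_on_chain`). Hence
  `H - z` is injective for every `z`. The adjoint is triangular in the opposite direction, so it is
  injective too, and the range of `H - z` is dense.
* For `t ≥ 0` let `ξ₀ = √t/2π`, so that the diagonal `(2πξ)² - t` vanishes at `ξ₀`. If `H f - t f`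
  has the indicator function of a short interval `(ξ₀, ξ₀ + c]` as Fourier transform, then the
  Fourier transform of `f` vanishes on the part of the chains below the interval, and is therefore
  `1/((2πξ)² - t)` on the interval, which is not square integrable. So `H - t` is not surjective
  (`not_surjective_hillOperator_sub`).
* For `z ∉ [0, ∞)` let `ρ = 1/((2πξ)² - z)`. The inverse is `ρ (1 + (∑ a_k T_{kc}) ρ)⁻¹` on the
  Fourier side, where `T_t` is translation by `t`. The operator in brackets is invertible since
  `(∑ a_k T_{kc}) ρ` becomes a strict contraction after conjugation with a weight: the weight decays
  so fast on a long interval that every translation by `kc` gains there more than `ρ` can lose, and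
  outside of the interval `ρ` itself is small (`exists_weight`, `isUnit_one_add_shiftSum_mul`).
-/

namespace Hill
open Filter Topology FourierTransform SchwartzMap
open scoped LineDeriv

/-! ### Weak derivatives and the Fourier transform -/

/-- The defining identity of a weak derivative extends by cutoffs from compactly supported test
functions to smooth functions which are square integrable together with their derivative. -/
theorem IsWeakDeriv.integral_deriv_smul_of_memLp {f g : L2} (h : IsWeakDeriv f g) {ψ : ℝ → ℝ}
    (hψ : ContDiff ℝ ∞ ψ) (h0 : MemLp ψ 2) (h1 : MemLp (deriv ψ) 2) :
    ∫ x, deriv ψ x • f x = -∫ x, ψ x • g x := by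
  let χ : ContDiffBump (0 : ℝ) := ⟨1, 2, one_pos, one_lt_two⟩
  have hχ : ContDiff ℝ ∞ χ := χ.contDiff
  have hχs : HasCompactSupport χ := χ.hasCompactSupport
  obtain ⟨C, hC⟩ := hχs.deriv.exists_bound_of_continuous (hχ.continuous_deriv (by simp))
  set s : ℕ → ℝ := fun n => ((n : ℝ) + 1)⁻¹ with hs
  have hs0 : ∀ n, 0 < s n := fun n => by positivity
  have hs1 : ∀ n, s n ≤ 1 := fun n => inv_le_one_of_one_le₀ (by simp)
  have hslim : Tendsto s atTop (𝓝 0) := by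
    simpa [hs] using tendsto_one_div_add_atTop_nhds_zero_nat (𝕜 := ℝ)
  set φ : ℕ → ℝ → ℝ := fun n x => χ (s n * x) * ψ x with hφ
  have hχn : ∀ n, ContDiff ℝ ∞ fun x : ℝ => χ (s n * x) := fun n =>
    hχ.comp (contDiff_const.mul contDiff_id)
  have hφd : ∀ n, ContDiff ℝ ∞ (φ n) := fun n => (hχn n).mul hψ
  have hφs : ∀ n, HasCompactSupport (φ n) := fun n =>
    (hχs.comp_homeomorph (Homeomorph.mulLeft₀ (s n) (hs0 n).ne')).mul_right
  have hder : ∀ n x, deriv (φ n) x = s n * deriv χ (s n * x) * ψ x + χ (s n * x) * deriv ψ x := by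
    intro n x
    have e1 : HasDerivAt (fun x => χ (s n * x)) (deriv χ (s n * x) * (s n * 1)) x :=
      ((hχ.differentiable (by simp)) (s n * x)).hasDerivAt.comp x ((hasDerivAt_id x).const_mul _)
    have e2 := (hψ.differentiable (by simp) x).hasDerivAt
    refine (e1.mul e2).deriv.trans ?_
    ring
  have hlim1 : ∀ x : ℝ, Tendsto (fun n => χ (s n * x)) atTop (𝓝 1) := by
    intro x
    have : Tendsto (fun n => χ (s n * x)) atTop (𝓝 (χ (0 * x))) :=
      (hχ.continuous.tendsto _).comp (hslim.mul_const x)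
    rwa [zero_mul, χ.one_of_mem_closedBall (Metric.mem_closedBall_self zero_le_one)] at this
  have hfint : ∀ {u : ℝ → ℝ} (k : L2), MemLp u 2 → Integrable (fun x => |u x| * ‖k x‖) := by
    intro u k hu
    exact hu.norm.integrable_mul (Lp.memLp k).norm
  have L : Tendsto (fun n => ∫ x, deriv (φ n) x • f x) atTop (𝓝 (∫ x, deriv ψ x • f x)) := by
    refine tendsto_integral_of_dominated_convergence
      (fun x => C * (|ψ x| * ‖f x‖) + |deriv ψ x| * ‖f x‖) (fun n => ?_)
      (((hfint f h0).const_mul C).add (hfint f h1)) (fun n => ?_) ?_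
    · exact ((hφd n).continuous_deriv (by simp)).aestronglyMeasurable.smul
        (Lp.aestronglyMeasurable f)
    · refine Eventually.of_forall fun x => ?_
      rw [norm_smul, hder, ← mul_assoc, ← add_mul]
      refine mul_le_mul_of_nonneg_right ((norm_add_le _ _).trans ?_) (norm_nonneg _)
      simp only [norm_mul, Real.norm_eq_abs]
      have b1 : |s n| ≤ 1 := by rw [abs_of_pos (hs0 n)]; exact hs1 n
      have b2 : |deriv χ (s n * x)| ≤ C := hC _
      have b3 : |χ (s n * x)| ≤ 1 := by rw [abs_of_nonneg χ.nonneg]; exact χ.le_one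
      have := mul_le_mul b1 b2 (abs_nonneg _) zero_le_one
      rw [one_mul] at this
      gcongr
      exact mul_le_of_le_one_left (abs_nonneg _) b3
    · refine Eventually.of_forall fun x => ?_
      simp only [hder]
      have a1 : Tendsto (fun n => s n * deriv χ (s n * x) * ψ x) atTop
          (𝓝 (0 * deriv χ (0 * x) * ψ x)) :=
        ((hslim.mul (((hχ.continuous_deriv (by simp)).tendsto _).comp
          (hslim.mul_const x))).mul_const _)
      have := (a1.add ((hlim1 x).mul_const (deriv ψ x))).smul_const (f x)
      simpa using this
  have R : Tendsto (fun n => -∫ x, φ n x • g x) atTop (𝓝 (-∫ x, ψ x • g x)) := by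
    refine (tendsto_integral_of_dominated_convergence
      (fun x => |ψ x| * ‖g x‖) (fun n => ?_) (hfint g h0) (fun n => ?_) ?_).neg
    · exact (hφd n).continuous.aestronglyMeasurable.smul (Lp.aestronglyMeasurable g)
    · refine Eventually.of_forall fun x => ?_
      rw [norm_smul]
      refine mul_le_mul_of_nonneg_right ?_ (norm_nonneg _)
      simp only [hφ, norm_mul, Real.norm_eq_abs]
      have b3 : |χ (s n * x)| ≤ 1 := by rw [abs_of_nonneg χ.nonneg]; exact χ.le_one
      exact mul_le_of_le_one_left (abs_nonneg _) b3
    · refine Eventually.of_forall fun x => ?_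
      have := ((hlim1 x).mul_const (ψ x)).smul_const (g x)
      simpa [hφ] using this
  exact tendsto_nhds_unique (L.congr fun n => h (φ n) (hφd n) (hφs n)) R

theorem exists_schwartzMap_eq_ofReal {φ : ℝ → ℝ} (hφ : ContDiff ℝ ∞ φ) (hs : HasCompactSupport φ) :
    ∃ ψ : 𝓢(ℝ, ℂ), ∀ x, ψ x = φ x := by
  have hs' : HasCompactSupport (Complex.ofRealCLM ∘ φ) := hs.comp_left (map_zero _)
  have hφ' : ContDiff ℝ ∞ (Complex.ofRealCLM ∘ φ) := by fun_prop
  exact ⟨hs'.toSchwartzMap hφ', fun x => by simp⟩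

/-- A weak derivative, tested against `C_c^∞`, is the same as a derivative of tempered
distributions. -/
theorem isWeakDeriv_iff_lineDeriv {f g : L2} :
    IsWeakDeriv f g ↔ ∂_{(1 : ℝ)} (f : 𝓢'(ℝ, ℂ)) = (g : 𝓢'(ℝ, ℂ)) := by
  constructor
  · intro h
    ext ψ
    have hd : ∀ x, HasDerivAt ψ (deriv ψ x) x := ψ.hasDerivAt
    have hm0 : MemLp ψ 2 := ψ.memLp 2
    have hm1 : MemLp (deriv ψ) 2 := by
      have := (SchwartzMap.derivCLM ℂ ℂ ψ).memLp 2
      rwa [show (SchwartzMap.derivCLM ℂ ℂ ψ : ℝ → ℂ) = deriv ψ from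
        funext fun x => SchwartzMap.derivCLM_apply ..] at this
    have hre : ∀ x, HasDerivAt (fun x => (ψ x).re) (deriv ψ x).re x := fun x =>
      Complex.reCLM.hasFDerivAt.comp_hasDerivAt x (hd x)
    have him : ∀ x, HasDerivAt (fun x => (ψ x).im) (deriv ψ x).im x := fun x =>
      Complex.imCLM.hasFDerivAt.comp_hasDerivAt x (hd x)
    have ere : deriv (fun x => (ψ x).re) = fun x => (deriv ψ x).re := funext fun x => (hre x).deriv
    have eim : deriv (fun x => (ψ x).im) = fun x => (deriv ψ x).im := funext fun x => (him x).deriv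
    have h1 := h.integral_deriv_smul_of_memLp (ψ := fun x => (ψ x).re)
      (Complex.reCLM.contDiff.comp (ψ.smooth ⊤)) hm0.re (by rw [ere]; exact hm1.re)
    have h2 := h.integral_deriv_smul_of_memLp (ψ := fun x => (ψ x).im)
      (Complex.imCLM.contDiff.comp (ψ.smooth ⊤)) hm0.im (by rw [eim]; exact hm1.im)
    rw [ere] at h1
    rw [eim] at h2
    -- Test functions in `IsWeakDeriv` are real: split `ψ` into real and imaginary part.
    have key : ∀ {u : ℝ → ℂ} (k : L2), MemLp u 2 → ∫ x, u x • k x =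
        (∫ x, (u x).re • k x) + Complex.I * ∫ x, (u x).im • k x := by
      intro u k hu
      have i1 : Integrable fun x => (u x).re • k x := by
        simpa using! hu.re.ofReal.integrable_mul (Lp.memLp k)
      have i2 : Integrable fun x => (u x).im • k x := by
        simpa using! hu.im.ofReal.integrable_mul (Lp.memLp k)
      rw [← integral_const_mul, ← integral_add i1 (i2.const_mul _)]
      congr 1
      ext x
      simp only [Complex.real_smul, smul_eq_mul]
      conv_lhs => rw [← Complex.re_add_im (u x)]
      ring
    rw [TemperedDistribution.lineDerivOp_apply_apply]
    simp only [Lp.toTemperedDistribution_apply, map_neg]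
    have e : ∀ x, (∂_{(1 : ℝ)} ψ) x = deriv ψ x := fun x => by
      rw [SchwartzMap.lineDerivOp_apply_eq_fderiv]; simp
    simp only [e]
    rw [key f hm1, key g hm0, h1, h2]
    ring
  · intro h φ hφ hs
    obtain ⟨ψ, hψ⟩ := exists_schwartzMap_eq_ofReal hφ hs
    have := congrArg (fun T : 𝓢'(ℝ, ℂ) => T ψ) h
    simp only [TemperedDistribution.lineDerivOp_apply_apply, Lp.toTemperedDistribution_apply,
      map_neg] at this
    have e : ∀ x, (∂_{(1 : ℝ)} ψ) x = ((deriv φ x : ℝ) : ℂ) := fun x => by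
      rw [SchwartzMap.lineDerivOp_apply_eq_fderiv, show (ψ : ℝ → ℂ) = fun x => (φ x : ℂ) from
        funext hψ]
      have : HasDerivAt (fun x => (φ x : ℂ)) ((deriv φ x : ℝ) : ℂ) x :=
        ((hφ.differentiable (by simp)) x).hasDerivAt.ofReal_comp
      simp [this.deriv]
    simp only [e, hψ, smul_eq_mul] at this
    rw [neg_eq_iff_eq_neg] at this
    simpa only [Complex.real_smul] using this

theorem isWeakDeriv_iff_fourier {f g : L2} :
    IsWeakDeriv f g ↔
      (𝓕 g : L2) =ᵐ[volume] fun ξ => 2 * Real.pi * Complex.I * ξ * (𝓕 f : L2) ξ := by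
  rw [isWeakDeriv_iff_lineDeriv, ← (fourierEquiv ℂ 𝓢'(ℝ, ℂ)).injective.eq_iff]
  simp only [fourierEquiv_apply]
  rw [TemperedDistribution.fourier_lineDerivOp_eq, Lp.fourier_toTemperedDistribution_eq,
    Lp.fourier_toTemperedDistribution_eq]
  have htg : (fun x : ℝ => (x : ℂ)).HasTemperateGrowth := by fun_prop
  have key : ∀ ψ : 𝓢(ℝ, ℂ), ((2 * Real.pi * Complex.I) •
      TemperedDistribution.smulLeftCLM ℂ (fun x : ℝ => ((inner ℝ x (1 : ℝ) : ℝ) : ℂ))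
        ((𝓕 f : L2) : 𝓢'(ℝ, ℂ))) ψ =
      ∫ x, ψ x * (2 * Real.pi * Complex.I * x * (𝓕 f : L2) x) := by
    intro ψ
    simp only [smul_apply,
      TemperedDistribution.smulLeftCLM_apply_apply,
      Lp.toTemperedDistribution_apply, smul_eq_mul]
    rw [← integral_const_mul]
    congr 1
    ext x
    simp [SchwartzMap.smulLeftCLM_apply_apply htg]
    ring
  constructor
  · intro h
    refine (ae_eq_of_integral_contDiff_smul_eq
      ((Lp.memLp _).locallyIntegrable (by norm_num)) ?_ fun φ hφ hs => ?_)
    · have : LocallyIntegrable (fun ξ => (𝓕 f : L2) ξ) :=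
        (Lp.memLp _).locallyIntegrable (by norm_num)
      rw [← locallyIntegrableOn_univ] at this ⊢
      exact this.continuousOn_mul (Continuous.continuousOn (by fun_prop))
        isOpen_univ.isLocallyClosed
    · obtain ⟨ψ, hψ⟩ := exists_schwartzMap_eq_ofReal hφ hs
      have := congrArg (fun T : 𝓢'(ℝ, ℂ) => T ψ) h
      rw [key, Lp.toTemperedDistribution_apply] at this
      simp only [hψ, smul_eq_mul] at this
      simpa only [Complex.real_smul] using this.symm
  · intro h
    ext ψ
    rw [key, Lp.toTemperedDistribution_apply]
    refine integral_congr_ae ?_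
    filter_upwards [h] with x hx
    rw [hx, smul_eq_mul]

/-- The symbol `(2πξ)²` of `-d²/dx²` for the Fourier transform `∫ e^{-2πixξ} f(x) dx`. -/
noncomputable def symbol (ξ : ℝ) : ℝ := (2 * Real.pi * ξ) ^ 2

theorem symbol_nonneg (ξ : ℝ) : 0 ≤ symbol ξ := sq_nonneg _

theorem continuous_symbol : Continuous symbol := by unfold symbol; fun_prop

theorem fourier_secondDeriv (f : W22) :
    (𝓕 (secondDeriv f) : L2) =ᵐ[volume] fun ξ => -(symbol ξ : ℂ) * (𝓕 (f : L2) : L2) ξ := by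
  obtain ⟨f₁, h₁, h₂⟩ := (exists_secondDeriv f).choose_spec
  filter_upwards [isWeakDeriv_iff_fourier.1 h₁, isWeakDeriv_iff_fourier.1 h₂] with ξ e₁ e₂
  refine e₂.trans ?_
  rw [e₁, symbol]
  push_cast
  linear_combination (2 * Real.pi * (ξ : ℂ)) ^ 2 * (𝓕 (f : L2) : L2) ξ * Complex.I_sq

/-- A function whose Fourier transform stays in `L²` after multiplication by `(2πξ)²` belongs
to `W^{2,2}`. -/
theorem mem_W22_of_fourier {f G : L2}
    (h : G =ᵐ[volume] fun ξ => (symbol ξ : ℂ) * (𝓕 f : L2) ξ) : f ∈ W22 := by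
  -- The first derivative is controlled through `2 |2πξ| ≤ 1 + (2πξ)²`.
  have hm : MemLp (fun ξ : ℝ => 2 * Real.pi * Complex.I * ξ * (𝓕 f : L2) ξ) 2 := by
    refine ((Lp.memLp (𝓕 f : L2)).norm.add (Lp.memLp G).norm).of_le
      ((Continuous.aestronglyMeasurable (by fun_prop)).mul (Lp.aestronglyMeasurable _)) ?_
    filter_upwards [h] with ξ hξ
    simp only [Pi.add_apply, hξ, norm_mul, Complex.norm_real, Complex.norm_I, mul_one,
      Real.norm_eq_abs, Complex.norm_ofNat]
    rw [abs_of_nonneg (symbol_nonneg ξ), ← one_add_mul,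
      abs_of_nonneg (a := (1 + symbol ξ) * _)
        (mul_nonneg (add_nonneg zero_le_one (symbol_nonneg ξ)) (norm_nonneg _))]
    refine mul_le_mul_of_nonneg_right ?_ (norm_nonneg _)
    have e : symbol ξ = (2 * |Real.pi| * |ξ|) ^ 2 := by
      rw [symbol, mul_pow, mul_pow, mul_pow, mul_pow, sq_abs, sq_abs]
    nlinarith [sq_nonneg (2 * |Real.pi| * |ξ| - 1)]
  refine ⟨𝓕⁻ hm.toLp, 𝓕⁻ (-G), isWeakDeriv_iff_fourier.2 ?_, isWeakDeriv_iff_fourier.2 ?_⟩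
  · rw [fourier_fourierInv_eq]
    exact hm.coeFn_toLp
  · rw [fourier_fourierInv_eq, fourier_fourierInv_eq]
    filter_upwards [Lp.coeFn_neg G, hm.coeFn_toLp, h] with ξ e₁ e₂ e₃
    rw [e₁, Pi.neg_apply, e₂, e₃, symbol]
    push_cast
    linear_combination -(2 * Real.pi * (ξ : ℂ)) ^ 2 * (𝓕 f : L2) ξ * Complex.I_sq

theorem eq_of_integral_schwartz {f g : L2} (h : ∀ ψ : 𝓢(ℝ, ℂ), ∫ x, ψ x * f x = ∫ x, ψ x * g x) :
    f = g := by
  have hinj := LinearMap.ker_eq_bot.1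
    (Lp.ker_toTemperedDistributionCLM_eq_bot (F := ℂ) (μ := (volume : Measure ℝ)) (p := 2))
  refine hinj ?_
  ext ψ
  simpa using h ψ

/-! ### Multiplication operators, translations and the Fourier transform -/

/-- Multiplication by a bounded continuous function, as a bounded operator on `L²(ℝ)`. -/
noncomputable def mulCLM (V : ℝ →ᵇ ℂ) : L2 →L[ℂ] L2 :=
  (mulOp V).mkContinuous ‖V‖ fun f => by
    refine Lp.norm_le_mul_norm_of_ae_le_mul ?_
    filter_upwards [(memLp_mul V f).coeFn_toLp] with x hx
    refine (congrArg norm hx).le.trans ?_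
    rw [norm_mul]
    exact mul_le_mul_of_nonneg_right (V.norm_coe_le_norm x) (norm_nonneg _)

theorem coeFn_mulCLM (V : ℝ →ᵇ ℂ) (f : L2) :
    mulCLM V f =ᵐ[volume] fun x => V x * f x :=
  (memLp_mul V f).coeFn_toLp

theorem norm_mulCLM_le (V : ℝ →ᵇ ℂ) : ‖mulCLM V‖ ≤ ‖V‖ :=
  LinearMap.mkContinuous_norm_le _ (norm_nonneg _) _

theorem mulCLM_mulCLM (V W : ℝ →ᵇ ℂ) (f : L2) : mulCLM V (mulCLM W f) = mulCLM (V * W) f := by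
  refine Lp.ext ?_
  filter_upwards [coeFn_mulCLM V (mulCLM W f), coeFn_mulCLM W f, coeFn_mulCLM (V * W) f]
    with x h₁ h₂ h₃
  rw [h₁, h₂, h₃, BoundedContinuousFunction.mul_apply, mul_assoc]

theorem mulCLM_one : mulCLM 1 = 1 := by
  ext1 f
  refine Lp.ext ?_
  filter_upwards [coeFn_mulCLM 1 f] with x h₁
  rw [h₁]
  simp

/-- `V ↦ mulCLM V` as a bounded linear map. -/
noncomputable def mulCLMCLM : (ℝ →ᵇ ℂ) →L[ℂ] (L2 →L[ℂ] L2) :=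
  LinearMap.mkContinuous
    { toFun := mulCLM
      map_add' := fun V W => by
        ext1 f
        refine Lp.ext ?_
        filter_upwards [coeFn_mulCLM (V + W) f, coeFn_mulCLM V f, coeFn_mulCLM W f,
          Lp.coeFn_add (mulCLM V f) (mulCLM W f)] with x h₁ h₂ h₃ h₄
        rw [h₁, BoundedContinuousFunction.add_apply, add_mul, ← h₂, ← h₃]
        exact h₄.symm
      map_smul' := fun c V => by
        ext1 f
        refine Lp.ext ?_
        filter_upwards [coeFn_mulCLM (c • V) f, coeFn_mulCLM V f,
          Lp.coeFn_smul c (mulCLM V f)] with x h₁ h₂ h₃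
        rw [h₁, BoundedContinuousFunction.smul_apply, smul_eq_mul, mul_assoc, ← h₂]
        exact h₃.symm } 1
    fun V => by rw [one_mul]; exact norm_mulCLM_le V

theorem mulCLMCLM_apply (V : ℝ →ᵇ ℂ) : mulCLMCLM V = mulCLM V := rfl

/-- The translation `f ↦ f(· - t)` of `L²(ℝ)`. -/
noncomputable def translate (t : ℝ) : L2 →ₗᵢ[ℂ] L2 :=
  Lp.compMeasurePreservingₗᵢ ℂ (fun x => x - t) (measurePreserving_sub_right volume t)

theorem coeFn_translate (t : ℝ) (f : L2) : translate t f =ᵐ[volume] fun x => f (x - t) :=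
  Lp.coeFn_compMeasurePreserving f (measurePreserving_sub_right volume t)

theorem ae_comp_sub {p : ℝ → Prop} (h : ∀ᵐ x, p x) (t : ℝ) : ∀ᵐ x : ℝ, p (x - t) :=
  (measurePreserving_sub_right volume t).quasiMeasurePreserving.ae h

theorem translate_neg_translate (t : ℝ) (f : L2) : translate (-t) (translate t f) = f := by
  refine Lp.ext ?_
  filter_upwards [coeFn_translate (-t) (translate t f), ae_comp_sub (coeFn_translate t f) (-t)]
    with x h₁ h₂
  rw [h₁, h₂, sub_neg_eq_add, add_sub_cancel_right]

theorem adjoint_translate (t : ℝ) :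
    ContinuousLinearMap.adjoint (translate t).toContinuousLinearMap =
      (translate (-t)).toContinuousLinearMap := by
  refine ((ContinuousLinearMap.eq_adjoint_iff _ _).2 fun f g => ?_).symm
  have := (translate t).inner_map_map (translate (-t) f) g
  have h := translate_neg_translate (-t) f
  rw [neg_neg] at h
  rw [h] at this
  exact this.symm

/-- The character `x ↦ e^{ikx}`. -/
noncomputable def expBCF (k : ℝ) : ℝ →ᵇ ℂ :=
  BoundedContinuousFunction.ofNormedAddCommGroup
    (fun x : ℝ => Complex.exp (Complex.I * k * x)) (by fun_prop) 1 fun x => by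
      rw [show Complex.I * k * x = ((k * x : ℝ) : ℂ) * Complex.I by push_cast; ring,
        Complex.norm_exp_ofReal_mul_I]

theorem expBCF_apply (k x : ℝ) : expBCF k x = Complex.exp (Complex.I * k * x) := rfl

theorem norm_expBCF_le (k : ℝ) : ‖expBCF k‖ ≤ 1 :=
  BoundedContinuousFunction.norm_ofNormedAddCommGroup_le _ zero_le_one _

/-- The Fourier transform turns multiplication by `e^{ikx}` into translation by `k / 2π`. -/
theorem fourier_mulCLM_expBCF (k : ℝ) (f : L2) :
    (𝓕 (mulCLM (expBCF k) f) : L2) = translate (k / (2 * Real.pi)) (𝓕 f) := by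
  set c := k / (2 * Real.pi) with hc
  have hF : ∀ (g : L2) (ψ : 𝓢(ℝ, ℂ)), ∫ x, ψ x * (𝓕 g : L2) x = ∫ x, (𝓕 ψ) x * g x := by
    intro g ψ
    have := congrArg (fun T : 𝓢'(ℝ, ℂ) => T ψ) (Lp.fourier_toTemperedDistribution_eq g)
    simp only [TemperedDistribution.fourier_apply, Lp.toTemperedDistribution_apply,
      smul_eq_mul] at this
    exact this.symm
  refine eq_of_integral_schwartz fun ψ => ?_
  -- Dually, `e^{ikx} 𝓕 ψ` is the Fourier transform of `ψ(· + c)`.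
  set χ : 𝓢(ℝ, ℂ) := SchwartzMap.compSubConstCLM ℂ (-c) ψ with hχ
  have hχx : ∀ x, χ x = ψ (x + c) := fun x => by
    rw [hχ, SchwartzMap.compSubConstCLM_apply, sub_neg_eq_add]
  have e1 : ∀ x : ℝ, (𝓕 χ) x = Complex.exp (Complex.I * k * x) * (𝓕 ψ) x := by
    intro x
    have h := congrFun (Fourier.fourierIntegral_comp_add_right Real.fourierChar volume ψ c) x
    have h2 : ∀ u : 𝓢(ℝ, ℂ), (𝓕 u) x = Fourier.fourierIntegral Real.fourierChar volume u x :=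
      fun u => by
        rw [SchwartzMap.fourier_coe, Real.fourier_eq, Fourier.fourierIntegral_def]
        congr 1
        ext v
        simp [mul_comm]
    rw [h2, h2]
    have h3 : (χ : ℝ → ℂ) = ψ ∘ fun v => v + c := funext hχx
    rw [h3, h, Circle.smul_def, Real.fourierChar_apply, smul_eq_mul]
    congr 2
    rw [hc]
    push_cast
    have : (Real.pi : ℂ) ≠ 0 := by exact_mod_cast Real.pi_ne_zero
    field_simp
  rw [hF]
  calc ∫ x, (𝓕 ψ) x * (mulCLM (expBCF k) f) x = ∫ x, (𝓕 χ) x * f x := by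
        refine integral_congr_ae ?_
        filter_upwards [coeFn_mulCLM (expBCF k) f] with x hx
        rw [hx, e1, expBCF_apply]
        ring
    _ = ∫ x, χ x * (𝓕 f : L2) x := (hF f χ).symm
    _ = ∫ x, ψ x * (𝓕 f : L2) (x - c) := by
        rw [← integral_sub_right_eq_self (fun x => χ x * (𝓕 f : L2) x) c]
        simp only [hχx, sub_add_cancel]
    _ = ∫ x, ψ x * (translate c (𝓕 f)) x := by
        refine integral_congr_ae ?_
        filter_upwards [coeFn_translate c (𝓕 f)] with x hx
        rw [hx]

/-- The operator `∑ a_k T_{kc}` on `L²(ℝ)`, where `T_t` is translation by `t`. For `c = 1/2π` it is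
multiplication by the potential, seen through the Fourier transform. -/
noncomputable def shiftSum (a : ℕ+ → ℂ) (c : ℝ) : L2 →L[ℂ] L2 :=
  ∑' k : ℕ+, a k • (translate (k * c)).toContinuousLinearMap

theorem norm_smul_translate_le (b : ℂ) (t : ℝ) :
    ‖b • (translate t).toContinuousLinearMap‖ ≤ ‖b‖ := by
  rw [norm_smul]
  exact mul_le_of_le_one_right (norm_nonneg _) (translate t).norm_toContinuousLinearMap_le

theorem hasSum_shiftSum {a : ℕ+ → ℂ} (ha : Summable fun k => ‖a k‖) (c : ℝ) :
    HasSum (fun k : ℕ+ => a k • (translate (k * c)).toContinuousLinearMap) (shiftSum a c) :=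
  (Summable.of_norm_bounded ha fun _ => norm_smul_translate_le _ _).hasSum

/-- The adjoint translates in the opposite direction, with conjugate coefficients. -/
theorem adjoint_shiftSum {a : ℕ+ → ℂ} (ha : Summable fun k => ‖a k‖) (c : ℝ) :
    ContinuousLinearMap.adjoint (shiftSum a c) = shiftSum (fun k => star (a k)) (-c) := by
  have h := (hasSum_shiftSum ha c).star
  simp only [ContinuousLinearMap.star_eq_adjoint] at h
  refine h.unique ?_
  convert hasSum_shiftSum (a := fun k => star (a k)) (by simpa using ha) (-c) using 2 with k
  rw [← ContinuousLinearMap.star_eq_adjoint, star_smul, ContinuousLinearMap.star_eq_adjoint,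
    adjoint_translate, mul_neg]

theorem hasSum_potential {a : ℕ+ → ℂ} (ha : Summable fun k => ‖a k‖) :
    HasSum (fun k : ℕ+ => a k • expBCF k) (potential a ha) := by
  have hs : Summable (fun k : ℕ+ => a k • expBCF k) := by
    refine Summable.of_norm_bounded ha fun k => ?_
    rw [norm_smul]
    exact mul_le_of_le_one_right (norm_nonneg _) (norm_expBCF_le _)
  convert hs.hasSum
  ext x
  have := (hs.hasSum.mapL (BoundedContinuousFunction.evalCLM ℂ x)).tsum_eq
  rw [BoundedContinuousFunction.evalCLM_apply] at this
  rw [← this]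
  simp [potential, expBCF_apply]

theorem fourier_mulOp_potential {a : ℕ+ → ℂ} (ha : Summable fun k => ‖a k‖) (f : L2) :
    (𝓕 (mulOp (potential a ha) f) : L2) = shiftSum a (2 * Real.pi)⁻¹ (𝓕 f) := by
  have h1 := ((hasSum_potential ha).mapL mulCLMCLM).mapL (ContinuousLinearMap.apply ℂ L2 f)
  have h2 := h1.mapL (Lp.fourierTransformₗᵢ ℝ ℂ).toContinuousLinearEquiv.toContinuousLinearMap
  have h3 := (hasSum_shiftSum ha (2 * Real.pi)⁻¹).mapL (ContinuousLinearMap.apply ℂ L2 (𝓕 f))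
  refine (h3.congr_fun fun k => ?_).unique h2 |>.symm
  simp only [ContinuousLinearMap.apply_apply]
  rw [map_smul, mulCLMCLM_apply, _root_.smul_apply, _root_.smul_apply,
    map_smul, ← div_eq_mul_inv]
  exact congrArg (a k • ·) (fourier_mulCLM_expBCF k f)

/-! ### Triangular equations on the chains `ξ + ℤc` -/

theorem ae_comp_add_zsmul {p : ℝ → Prop} (h : ∀ᵐ x, p x) (c : ℝ) :
    ∀ᵐ x : ℝ, ∀ n : ℤ, p (x + n * c) := by
  refine ae_all_iff.2 fun n => ?_
  simpa using ae_comp_sub h (-(n * c))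

/-- Almost every chain `ξ + ℤc` carries only a bounded sequence of values of a square integrable
function: the integral of `∑ₙ |g(ξ + nc)|²` over a period is `‖g‖²`. -/
theorem ae_bounded_on_chain (g : L2) {c : ℝ} (hc : 0 < c) :
    ∀ᵐ ξ : ℝ, ∃ C : ℝ, ∀ n : ℤ, ‖g (ξ + n * c)‖ ≤ C := by
  have hmeas : Measurable fun x => ‖g x‖ₑ ^ 2 :=
    (Lp.stronglyMeasurable g).measurable.enorm.pow_const 2
  have hfin : ∫⁻ x, ‖g x‖ₑ ^ 2 ≠ ⊤ := by
    have := (eLpNorm_lt_top_iff_lintegral_rpow_enorm_lt_top (p := 2) (by norm_num)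
      (by norm_num)).1 (Lp.memLp g).2
    simpa using this.ne
  have key : ∀ j : ℤ, ∀ᵐ ξ : ℝ, ξ ∈ Set.Ioc (j * c) (j * c + c) →
      ∃ C : ℝ, ∀ n : ℤ, ‖g (ξ + n * c)‖ ≤ C := by
    intro j
    rw [← ae_restrict_iff' measurableSet_Ioc]
    have h1 := (isAddFundamentalDomain_Ioc hc (j * c) volume).lintegral_eq_tsum''
      (fun x => ‖g x‖ₑ ^ 2)
    have hm : ∀ n : AddSubgroup.zmultiples c, Measurable fun x => ‖g (n +ᵥ x)‖ₑ ^ 2 :=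
      fun n => hmeas.comp (measurable_const_vadd n)
    rw [← lintegral_tsum fun n => (hm n).aemeasurable] at h1
    rw [h1] at hfin
    filter_upwards [ae_lt_top (Measurable.tsum hm) hfin] with ξ hξ
    refine ⟨Real.sqrt (∑' n : AddSubgroup.zmultiples c, ‖g (n +ᵥ ξ)‖ₑ ^ 2).toReal, fun n => ?_⟩
    refine Real.le_sqrt_of_sq_le ?_
    have h2 := ENNReal.le_tsum (f := fun n : AddSubgroup.zmultiples c => ‖g (n +ᵥ ξ)‖ₑ ^ 2)
      ⟨n • c, n, rfl⟩
    have h3 := ENNReal.toReal_mono hξ.ne h2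
    refine le_trans (le_of_eq ?_) h3
    rw [ENNReal.toReal_pow, toReal_enorm]
    congr 3
    rw [AddSubgroup.vadd_def]
    simp [add_comm]
  filter_upwards [ae_all_iff.2 key] with ξ hξ
  obtain ⟨j, hj, -⟩ := existsUnique_add_zsmul_mem_Ioc hc ξ 0
  refine hξ (-j) ?_
  simp only [zsmul_eq_mul, zero_add, Set.mem_Ioc] at hj
  push_cast
  constructor <;> linarith [hj.1, hj.2]

theorem ae_shiftSum_eq {a : ℕ+ → ℂ} (ha : Summable fun k => ‖a k‖) {c : ℝ} (hc : c ≠ 0) (f : L2) :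
    ∀ᵐ ξ, shiftSum a c f ξ = ∑' k : ℕ+, a k * f (ξ - k * c) := by
  have hbd : ∀ᵐ ξ : ℝ, ∃ C : ℝ, ∀ k : ℕ+, ‖f (ξ - k * c)‖ ≤ C := by
    rcases lt_or_gt_of_ne hc with h | h
    · filter_upwards [ae_bounded_on_chain f (neg_pos.2 h)] with ξ ⟨C, hC⟩
      exact ⟨C, fun k => by simpa [sub_eq_add_neg] using hC k⟩
    · filter_upwards [ae_bounded_on_chain f h] with ξ ⟨C, hC⟩
      exact ⟨C, fun k => by simpa [sub_eq_add_neg] using hC (-k)⟩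
  have h1 := (hasSum_shiftSum ha c).mapL (ContinuousLinearMap.apply ℂ L2 f)
  simp only [ContinuousLinearMap.apply_apply, _root_.smul_apply,
    LinearIsometry.coe_toContinuousLinearMap] at h1
  obtain ⟨ns, hns, hlim⟩ := (tendstoInMeasure_of_tendsto_Lp h1).exists_seq_tendsto_ae'
  have hpart : ∀ᵐ ξ, ∀ s : Finset ℕ+,
      (∑ k ∈ s, a k • translate (k * c) f : L2) ξ = ∑ k ∈ s, a k * f (ξ - k * c) := by
    refine ae_all_iff.2 fun s => ?_
    have hall : ∀ᵐ ξ, ∀ k : ℕ+, (a k • translate (k * c) f : L2) ξ = a k * f (ξ - k * c) := by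
      refine ae_all_iff.2 fun k => ?_
      filter_upwards [Lp.coeFn_smul (a k) (translate (k * c) f), coeFn_translate (k * c) f]
        with ξ e1 e2
      rw [e1, Pi.smul_apply, e2, smul_eq_mul]
    filter_upwards [hall, Lp.coeFn_fun_finsetSum s fun k => a k • translate (k * c) f]
      with ξ e1 e2
    rw [e2]
    simp only [e1]
  filter_upwards [hbd, hlim, hpart] with ξ ⟨C, hC⟩ e1 e2
  have hs : Summable fun k : ℕ+ => a k * f (ξ - k * c) := by
    refine Summable.of_norm_bounded (ha.mul_right C) fun k => ?_
    rw [norm_mul]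
    exact mul_le_mul_of_nonneg_left (hC k) (norm_nonneg _)
  simp only [e2] at e1
  exact tendsto_nhds_unique e1 (hs.hasSum.comp hns)

/-- The triangular system `lₙ uₙ = -∑_{k ≥ 1} a_k u_{n+k}` has no bounded solution besides zero if
the diagonal `lₙ` has no zero and tends to infinity. -/
theorem eq_zero_of_triangular {a : ℕ+ → ℂ} (ha : Summable fun k => ‖a k‖) {l u : ℕ → ℂ}
    (hl : Tendsto (fun n => ‖l n‖) atTop atTop) (hl0 : ∀ n, l n ≠ 0) {C : ℝ}
    (hu : ∀ n, ‖u n‖ ≤ C) (h : ∀ n, l n * u n = -∑' k : ℕ+, a k * u (n + k)) (n : ℕ) :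
    u n = 0 := by
  set A := ∑' k, ‖a k‖ with hA
  have hA0 : 0 ≤ A := tsum_nonneg fun k => norm_nonneg _
  obtain ⟨N, hN⟩ := (hl.eventually_ge_atTop (2 * A + 1)).exists_forall_of_atTop
  have hC0 : 0 ≤ C := (norm_nonneg _).trans (hu 0)
  -- Beyond `N` the diagonal dominates, so every bound on the tail can be halved.
  have half : ∀ j : ℕ, ∀ n ≥ N, ‖u n‖ ≤ C / 2 ^ j := by
    intro j
    induction j with
    | zero => intro n _; simpa using hu n
    | succ j ih =>
      intro n hn
      have b1 : ‖∑' k : ℕ+, a k * u (n + k)‖ ≤ A * (C / 2 ^ j) := by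
        refine tsum_of_norm_bounded (ha.hasSum.mul_right (C / 2 ^ j)) fun k => ?_
        rw [norm_mul]
        exact mul_le_mul_of_nonneg_left (ih _ (by omega)) (norm_nonneg _)
      have b2 : ‖l n‖ * ‖u n‖ ≤ A * (C / 2 ^ j) := by rw [← norm_mul, h n, norm_neg]; exact b1
      have b3 := mul_le_mul_of_nonneg_right (hN n hn) (norm_nonneg (u n))
      have hD : 0 ≤ C / 2 ^ j := by positivity
      have e : C / 2 ^ (j + 1) = (C / 2 ^ j) / 2 := by rw [pow_succ]; field_simp
      rw [e]
      by_contra hlt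
      push Not at hlt
      nlinarith
  have tail : ∀ n ≥ N, u n = 0 := by
    intro n hn
    have lim : Tendsto (fun j : ℕ => C / 2 ^ j) atTop (𝓝 0) := by
      have := (tendsto_pow_atTop_nhds_zero_of_lt_one (r := (1 / 2 : ℝ)) (by norm_num)
        (by norm_num)).const_mul C
      simpa [div_eq_mul_inv] using this
    exact norm_le_zero_iff.1 (ge_of_tendsto' lim fun j => half j n hn)
  have down : ∀ d n, N ≤ n + d → u n = 0 := by
    intro d
    induction d with
    | zero => exact fun n hn => tail n hn
    | succ d ih =>
      intro n hn
      have : ∑' k : ℕ+, a k * u (n + k) = 0 := by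
        rw [← tsum_zero]
        refine tsum_congr fun k => ?_
        rw [ih (n + k) (by have := k.pos; omega), mul_zero]
      have h2 := h n
      rw [this, neg_zero] at h2
      exact (mul_eq_zero.1 h2).resolve_left (hl0 n)
  exact down N n (by omega)

theorem tendsto_symbol_chain (ξ : ℝ) {c : ℝ} (hc : c ≠ 0) (z : ℂ) :
    Tendsto (fun n : ℕ => ‖(symbol (ξ - (n + 1) * c) : ℂ) - z‖) atTop atTop := by
  have h1 : Tendsto (fun n : ℕ => |ξ - ((n : ℝ) + 1) * c|) atTop atTop := by
    have h0 : Tendsto (fun n : ℕ => ((n : ℝ) + 1) * |c| - |ξ|) atTop atTop :=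
      tendsto_atTop_add_const_right _ _ ((tendsto_atTop_add_const_right _ _
        tendsto_natCast_atTop_atTop).atTop_mul_const (abs_pos.2 hc))
    refine tendsto_atTop_mono (fun n => ?_) h0
    have := abs_sub_abs_le_abs_sub (((n : ℝ) + 1) * c) ξ
    rw [abs_mul, abs_of_nonneg (by positivity : (0 : ℝ) ≤ (n : ℝ) + 1), abs_sub_comm] at this
    exact this
  have h2 : Tendsto (fun n : ℕ => symbol (ξ - (n + 1) * c) - ‖z‖) atTop atTop := by
    refine tendsto_atTop_add_const_right _ _ ?_
    have := ((tendsto_pow_atTop two_ne_zero).comp h1).const_mul_atTop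
      (show (0 : ℝ) < (2 * Real.pi) ^ 2 by positivity)
    refine this.congr fun n => ?_
    simp only [Function.comp, symbol, sq_abs]
    ring
  refine tendsto_atTop_mono (fun n => ?_) h2
  have := norm_sub_norm_le (symbol (ξ - (n + 1) * c) : ℂ) z
  rwa [Complex.norm_real, Real.norm_eq_abs, abs_of_nonneg (symbol_nonneg _)] at this

theorem ae_symbol_ne (z : ℂ) : ∀ᵐ ξ : ℝ, (symbol ξ : ℂ) - z ≠ 0 := by
  have hsub : {ξ : ℝ | ¬ (symbol ξ : ℂ) - z ≠ 0} ⊆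
      {Real.sqrt z.re / (2 * Real.pi), -(Real.sqrt z.re / (2 * Real.pi))} := by
    intro ξ hξ
    simp only [ne_eq, not_not, Set.mem_ofPred_eq, sub_eq_zero] at hξ
    have h1 : symbol ξ = z.re := by rw [← hξ, Complex.ofReal_re]
    have h2 : Real.sqrt z.re = |2 * Real.pi * ξ| := by rw [← h1, symbol, Real.sqrt_sq_eq_abs]
    rw [abs_mul, abs_of_pos (by positivity : (0 : ℝ) < 2 * Real.pi)] at h2
    have h3 : Real.sqrt z.re / (2 * Real.pi) = |ξ| := by
      rw [h2]; field_simp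
    rw [h3]
    rcases abs_choice ξ with h | h <;> rw [h] <;> simp
  exact measure_mono_null hsub (Set.Finite.measure_zero (Set.toFinite _) _)

/-- Where the right-hand side of `((2πξ)² - z) f + ∑ a_k f(· - kc) = h` vanishes along the chain
`ξ - c, ξ - 2c, …`, so does the solution `f`: on that chain the equation is triangular. -/
theorem ae_eq_zero_on_chain {a : ℕ+ → ℂ} (ha : Summable fun k => ‖a k‖) {c : ℝ} (hc : c ≠ 0)
    {z : ℂ} {f : L2} {h : ℝ → ℂ}
    (hf : ∀ᵐ ξ : ℝ, ((symbol ξ : ℂ) - z) * f ξ + shiftSum a c f ξ = h ξ) :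
    ∀ᵐ ξ : ℝ, (∀ n : ℕ, h (ξ - (n + 1) * c) = 0) → ∀ n : ℕ, f (ξ - (n + 1) * c) = 0 := by
  have hbd : ∀ᵐ ξ : ℝ, ∃ C : ℝ, ∀ n : ℕ, ‖f (ξ - (n + 1) * c)‖ ≤ C := by
    rcases lt_or_gt_of_ne hc with h | h
    · filter_upwards [ae_bounded_on_chain f (neg_pos.2 h)] with ξ ⟨C, hC⟩
      exact ⟨C, fun n => by simpa [sub_eq_add_neg] using hC (n + 1)⟩
    · filter_upwards [ae_bounded_on_chain f h] with ξ ⟨C, hC⟩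
      exact ⟨C, fun n => by
        have := hC (-(n + 1))
        push_cast at this
        rwa [neg_mul, ← sub_eq_add_neg] at this⟩
  have hpt : ∀ᵐ ξ : ℝ, ((symbol ξ : ℂ) - z) * f ξ + ∑' k : ℕ+, a k * f (ξ - k * c) = h ξ ∧
      (symbol ξ : ℂ) - z ≠ 0 := by
    filter_upwards [hf, ae_shiftSum_eq ha hc f, ae_symbol_ne z] with ξ e1 e2 e3
    exact ⟨by rw [← e2, e1], e3⟩
  filter_upwards [hbd, ae_comp_add_zsmul hpt c] with ξ ⟨C, hC⟩ hξ h0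
  have hξ' : ∀ n : ℕ, ((symbol (ξ - (n + 1) * c) : ℂ) - z) * f (ξ - (n + 1) * c) +
      ∑' k : ℕ+, a k * f (ξ - (n + 1) * c - k * c) = h (ξ - (n + 1) * c) ∧
      (symbol (ξ - (n + 1) * c) : ℂ) - z ≠ 0 := fun n => by
    have := hξ (-(n + 1))
    push_cast at this
    rwa [neg_mul, ← sub_eq_add_neg] at this
  refine eq_zero_of_triangular ha (l := fun n => (symbol (ξ - (n + 1) * c) : ℂ) - z)
    (u := fun n => f (ξ - (n + 1) * c)) (tendsto_symbol_chain ξ hc z) (fun n => (hξ' n).2) hC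
    fun n => ?_
  have e := (hξ' n).1
  rw [h0 n] at e
  rw [eq_neg_of_add_eq_zero_left e]
  refine congrArg _ (tsum_congr fun k => ?_)
  congr 2
  push_cast
  ring

/-- The homogeneous equation `((2πξ)² - z) f + ∑ a_k f(· - kc) = 0` has only the zero solution in
`L²(ℝ)`. The step `c` may have either sign, so this covers `H - z` and its adjoint. -/
theorem eq_zero_of_shift_equation {a : ℕ+ → ℂ} (ha : Summable fun k => ‖a k‖) {c : ℝ} (hc : c ≠ 0)
    {z : ℂ} {f : L2} (hf : ∀ᵐ ξ : ℝ, ((symbol ξ : ℂ) - z) * f ξ + shiftSum a c f ξ = 0) :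
    f = 0 := by
  refine Lp.ext ?_
  have h1 := ae_comp_sub (ae_eq_zero_on_chain ha hc (h := 0) hf) (-c)
  filter_upwards [h1, Lp.coeFn_zero ℂ 2 (volume : Measure ℝ)] with ξ h2 h3
  have := h2 (fun n => rfl) 0
  rw [h3]
  simpa using this

/-! ### Injectivity, dense range and failure of surjectivity -/

/-- On the Fourier side `H - z` is multiplication by `(2πξ)² - z` plus a sum of translations. -/
theorem fourier_hillOperator_sub {a : ℕ+ → ℂ} (ha : Summable fun k => ‖a k‖) (z : ℂ)
    (f : (hillOperator (potential a ha)).domain) :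
    (𝓕 (hillOperator (potential a ha) f - z • (f : L2)) : L2) =ᵐ[volume] fun ξ =>
      ((symbol ξ : ℂ) - z) * (𝓕 (f : L2) : L2) ξ +
        shiftSum a (2 * Real.pi)⁻¹ (𝓕 (f : L2)) ξ := by
  have e : (𝓕 (hillOperator (potential a ha) f - z • (f : L2)) : L2) =
      -𝓕 (secondDeriv f) + shiftSum a (2 * Real.pi)⁻¹ (𝓕 (f : L2)) - z • 𝓕 (f : L2) := by
    rw [← fourier_mulOp_potential ha]
    have e1 : hillOperator (potential a ha) f =
      -secondDeriv f + mulOp (potential a ha) (f : L2) := rfl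
    rw [e1]
    have hl : ∀ u : L2, (𝓕 u : L2) = Lp.fourierTransformₗᵢ ℝ ℂ u := fun _ => rfl
    simp only [hl, map_sub, map_add, map_neg, map_smul]
  rw [e]
  set p : L2 := 𝓕 (secondDeriv f) with hp
  set q : L2 := 𝓕 (f : L2) with hq
  filter_upwards [Lp.coeFn_sub (-p + shiftSum a (2 * Real.pi)⁻¹ q) (z • q),
    Lp.coeFn_add (-p) (shiftSum a (2 * Real.pi)⁻¹ q), Lp.coeFn_neg p, Lp.coeFn_smul z q,
    fourier_secondDeriv f] with ξ h1 h2 h3 h4 h5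
  rw [h1, Pi.sub_apply, h2, Pi.add_apply, h3, Pi.neg_apply, h4, Pi.smul_apply, smul_eq_mul]
  rw [← hp, ← hq] at h5
  rw [h5]
  ring

theorem injective_hillOperator_sub {a : ℕ+ → ℂ} (ha : Summable fun k => ‖a k‖) (z : ℂ) :
    Function.Injective fun f : (hillOperator (potential a ha)).domain =>
      hillOperator (potential a ha) f - z • (f : L2) := by
  intro f g hfg
  rw [← sub_eq_zero]
  have h0 : hillOperator (potential a ha) (f - g) - z • ((f - g :
      (hillOperator (potential a ha)).domain) : L2) = 0 := by
    have := sub_eq_zero.2 hfg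
    rw [← this, LinearPMap.map_sub, Submodule.coe_sub]
    module
  have h1 := fourier_hillOperator_sub ha z (f - g)
  rw [h0, show (𝓕 (0 : L2) : L2) = 0 from (Lp.fourierTransformₗᵢ ℝ ℂ).map_zero] at h1
  have h2 : (𝓕 ((f - g : (hillOperator (potential a ha)).domain) : L2) : L2) = 0 := by
    refine eq_zero_of_shift_equation ha (c := (2 * Real.pi)⁻¹) (by positivity) (z := z) ?_
    filter_upwards [h1, Lp.coeFn_zero ℂ 2 (volume : Measure ℝ)] with ξ e1 e2
    rw [← e1, e2, Pi.zero_apply]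
  exact Subtype.ext ((Lp.fourierTransformₗᵢ ℝ ℂ).map_eq_zero_iff.1 h2)

/-- The symbol `1 / ((2πξ)² - z)` of the resolvent of `-d²/dx²` at `z ∉ [0, ∞)` is a bounded
continuous function. -/
theorem exists_resolvent_symbol {z : ℂ} (hz : ¬ ∃ t : ℝ, 0 ≤ t ∧ z = t) :
    ∃ ρ : ℝ →ᵇ ℂ, ∀ ξ, ρ ξ = ((symbol ξ : ℂ) - z)⁻¹ := by
  have hcl : IsClosed ((fun t : ℝ => (t : ℂ)) '' Set.Ici 0) :=
    Complex.isometry_ofReal.isClosedEmbedding.isClosedMap _ isClosed_Ici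
  have hz' : z ∈ ((fun t : ℝ => (t : ℂ)) '' Set.Ici 0)ᶜ := by
    rintro ⟨t, ht, rfl⟩
    exact hz ⟨t, ht, rfl⟩
  obtain ⟨δ, hδ, hb⟩ := Metric.isOpen_iff.1 hcl.isOpen_compl z hz'
  have hlow : ∀ ξ, δ ≤ ‖(symbol ξ : ℂ) - z‖ := by
    intro ξ
    by_contra hlt
    push Not at hlt
    exact hb (mem_ball_iff_norm.2 hlt) ⟨symbol ξ, symbol_nonneg ξ, rfl⟩
  have hne : ∀ ξ, (symbol ξ : ℂ) - z ≠ 0 := fun ξ => norm_pos_iff.1 (hδ.trans_le (hlow ξ))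
  refine ⟨BoundedContinuousFunction.ofNormedAddCommGroup (fun ξ => ((symbol ξ : ℂ) - z)⁻¹) ?_ δ⁻¹
    fun ξ => ?_, fun ξ => rfl⟩
  · have := continuous_symbol
    exact Continuous.inv₀ (by fun_prop) hne
  · rw [norm_inv]
    exact inv_anti₀ hδ (hlow ξ)

theorem symbol_sub_ne {z : ℂ} (hz : ¬ ∃ t : ℝ, 0 ≤ t ∧ z = t) (ξ : ℝ) : (symbol ξ : ℂ) - z ≠ 0 :=
  fun h => hz ⟨symbol ξ, symbol_nonneg ξ, (sub_eq_zero.1 h).symm⟩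

theorem fourierInv_mulCLM_mem_W22 {z : ℂ} (hz : ¬ ∃ t : ℝ, 0 ≤ t ∧ z = t) {ρ : ℝ →ᵇ ℂ}
    (hρ : ∀ ξ, ρ ξ = ((symbol ξ : ℂ) - z)⁻¹) (g : L2) : (𝓕⁻ (mulCLM ρ g) : L2) ∈ W22 := by
  refine mem_W22_of_fourier (G := g + z • mulCLM ρ g) ?_
  rw [fourier_fourierInv_eq]
  filter_upwards [Lp.coeFn_add g (z • mulCLM ρ g), Lp.coeFn_smul z (mulCLM ρ g),
    coeFn_mulCLM ρ g] with ξ h1 h2 h3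
  rw [h1, Pi.add_apply, h2, Pi.smul_apply, h3, hρ, smul_eq_mul]
  field_simp [symbol_sub_ne hz ξ]
  ring

theorem adjoint_mulCLM (V : ℝ →ᵇ ℂ) :
    ContinuousLinearMap.adjoint (mulCLM V) = mulCLM (star V) := by
  refine ((ContinuousLinearMap.eq_adjoint_iff _ _).2 fun f g => ?_).symm
  rw [L2.inner_def, L2.inner_def]
  refine integral_congr_ae ?_
  filter_upwards [coeFn_mulCLM (star V) f, coeFn_mulCLM V g] with x h1 h2
  rw [h1, h2]
  simp
  ring

/-- The range of `H - z` is dense. On the Fourier side it contains the range of the bounded operator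
`B = (H - z)(H₀ + 1)⁻¹`, where `H₀ = -d²/dx²`, and the adjoint of `B` is injective. -/
theorem denseRange_hillOperator_sub {a : ℕ+ → ℂ} (ha : Summable fun k => ‖a k‖) (z : ℂ) :
    DenseRange fun f : (hillOperator (potential a ha)).domain =>
      hillOperator (potential a ha) f - z • (f : L2) := by
  set c : ℝ := (2 * Real.pi)⁻¹ with hc
  set T := hillOperator (potential a ha) with hT
  set A : T.domain →ₗ[ℂ] L2 := T.toFun - z • T.domain.subtype with hA
  change Dense (Set.range A)
  rw [← LinearMap.coe_range, Submodule.dense_iff_topologicalClosure_eq_top,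
    Submodule.topologicalClosure_eq_top_iff, Submodule.eq_bot_iff]
  intro h hh
  have hneg : ¬ ∃ t : ℝ, 0 ≤ t ∧ (-1 : ℂ) = t := by
    rintro ⟨t, ht, e⟩
    have := congrArg Complex.re e
    simp at this
    linarith
  obtain ⟨ρ, hρ⟩ := exists_resolvent_symbol hneg
  -- `μ = ((2πξ)² - z) / ((2πξ)² + 1)`
  set μ : ℝ →ᵇ ℂ := 1 - (z + 1) • ρ with hμ
  have hμρ : ∀ ξ, μ ξ = ((symbol ξ : ℂ) - z) * ρ ξ := by
    intro ξ
    have := symbol_sub_ne hneg ξ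
    have e : μ ξ = 1 - (z + 1) * ρ ξ := rfl
    rw [e, hρ]
    field_simp
    ring
  set B : L2 →L[ℂ] L2 := mulCLM μ + (shiftSum a c).comp (mulCLM ρ) with hB
  have hrange : ∀ g : L2, ∃ f : T.domain, (𝓕 (A f) : L2) = B g := by
    intro g
    refine ⟨⟨𝓕⁻ (mulCLM ρ g), fourierInv_mulCLM_mem_W22 hneg hρ g⟩, Lp.ext ?_⟩
    have h1 := fourier_hillOperator_sub ha z
      ⟨𝓕⁻ (mulCLM ρ g), fourierInv_mulCLM_mem_W22 hneg hρ g⟩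
    simp only [fourier_fourierInv_eq] at h1
    filter_upwards [h1, Lp.coeFn_add (mulCLM μ g) (shiftSum a c (mulCLM ρ g)), coeFn_mulCLM μ g,
      coeFn_mulCLM ρ g] with ξ e1 e2 e3 e4
    refine e1.trans ?_
    refine Eq.trans ?_ e2.symm
    rw [Pi.add_apply, e3, hμρ, e4, mul_assoc]
  have hadj : ContinuousLinearMap.adjoint B (𝓕 h) = 0 := by
    refine ext_inner_left ℂ fun g => ?_
    rw [ContinuousLinearMap.adjoint_inner_right, inner_zero_right]
    obtain ⟨f, hf⟩ := hrange g
    rw [← hf, Lp.inner_fourier_eq]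
    exact hh _ ⟨f, rfl⟩
  have hadj2 : mulCLM (star μ) (𝓕 h) +
      mulCLM (star ρ) (shiftSum (fun k => star (a k)) (-c) (𝓕 h)) = 0 := by
    rw [← hadj, hB, map_add, ContinuousLinearMap.adjoint_comp, adjoint_mulCLM, adjoint_mulCLM,
      adjoint_shiftSum ha]
    rfl
  have h0 : (𝓕 h : L2) = 0 := by
    refine eq_zero_of_shift_equation (a := fun k => star (a k)) (by simpa using ha) (c := -c)
      (neg_ne_zero.2 (by positivity)) (z := star z) ?_
    set q : L2 := 𝓕 h
    set S := shiftSum (fun k => star (a k)) (-c) q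
    have h2 := Lp.coeFn_add (mulCLM (star μ) q) (mulCLM (star ρ) S)
    rw [hadj2] at h2
    filter_upwards [h2, coeFn_mulCLM (star μ) q, coeFn_mulCLM (star ρ) S,
      Lp.coeFn_zero ℂ 2 (volume : Measure ℝ)] with ξ e1 e2 e3 e4
    rw [e4, Pi.zero_apply, Pi.add_apply, e2, e3, BoundedContinuousFunction.star_apply,
      BoundedContinuousFunction.star_apply, hμρ, star_mul, mul_assoc, ← mul_add] at e1
    have hne : star (ρ ξ) ≠ 0 := by
      rw [star_ne_zero, hρ]
      exact inv_ne_zero (symbol_sub_ne hneg ξ)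
    have := (mul_eq_zero.1 e1.symm).resolve_left hne
    simpa using this
  exact (Lp.fourierTransformₗᵢ ℝ ℂ).map_eq_zero_iff.1 h0

/-- `H - t` is not onto for `t ≥ 0`: a preimage of a function whose Fourier transform is the
indicator of an interval starting at `ξ₀ = √t / 2π` would have the Fourier transform
`1 / ((2πξ)² - t)` on that interval, which is not integrable at `ξ₀`. -/
theorem not_surjective_hillOperator_sub {a : ℕ+ → ℂ} (ha : Summable fun k => ‖a k‖) {t : ℝ}
    (ht : 0 ≤ t) : ¬ Function.Surjective fun f : (hillOperator (potential a ha)).domain =>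
      hillOperator (potential a ha) f - (t : ℂ) • (f : L2) := by
  intro hsurj
  set c : ℝ := (2 * Real.pi)⁻¹ with hc
  have hc0 : 0 < c := by positivity
  set ξ₀ : ℝ := Real.sqrt t / (2 * Real.pi) with hξ₀
  have hξ₀0 : 0 ≤ ξ₀ := by positivity
  have hsym : symbol ξ₀ = t := by
    have : 2 * Real.pi * ξ₀ = Real.sqrt t := by rw [hξ₀]; field_simp
    rw [symbol, this, Real.sq_sqrt ht]
  set I : Set ℝ := Set.Ioc ξ₀ (ξ₀ + c) with hI
  have hIm : MeasurableSet I := measurableSet_Ioc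
  set h : L2 := indicatorConstLp 2 hIm (by simp [hI]) (1 : ℂ) with hh
  obtain ⟨f, hf⟩ := hsurj (𝓕⁻ h)
  have h1 := fourier_hillOperator_sub ha t f
  simp only at hf
  rw [hf, fourier_fourierInv_eq, ← hc] at h1
  set q : L2 := 𝓕 (f : L2) with hq
  have h2 : ∀ᵐ ξ : ℝ, ((symbol ξ : ℂ) - t) * q ξ + shiftSum a c q ξ =
      I.indicator (fun _ => (1 : ℂ)) ξ := by
    filter_upwards [h1, indicatorConstLp_coeFn (p := 2) (hs := hIm) (hμs := by simp [hI])
      (c := (1 : ℂ))] with ξ e1 e2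
    rw [← e1, ← e2]
  have h3 : ∀ᵐ ξ : ℝ, ξ ∈ I → ((symbol ξ : ℂ) - t) * q ξ = 1 := by
    filter_upwards [h2, ae_eq_zero_on_chain ha hc0.ne' h2, ae_shiftSum_eq ha hc0.ne' q]
      with ξ e1 e2 e3 hξ
    have e4 : ∀ n : ℕ, I.indicator (fun _ => (1 : ℂ)) (ξ - (n + 1) * c) = 0 := by
      intro n
      refine Set.indicator_of_notMem (fun hmem => ?_) _
      have : 0 ≤ (n : ℝ) * c := by positivity
      linarith [hmem.1, hξ.2]
    -- The chain below `ξ` misses the interval, so `q` vanishes on it.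
    have e5 : ∑' k : ℕ+, a k * q (ξ - k * c) = 0 := by
      rw [← tsum_zero]
      refine tsum_congr fun k => ?_
      have := e2 e4 (PNat.natPred k)
      rw [show ((PNat.natPred k : ℕ) : ℝ) + 1 = k by exact_mod_cast PNat.natPred_add_one k] at this
      rw [this, mul_zero]
    rwa [e3, e5, add_zero, Set.indicator_of_mem hξ] at e1
  have hint : IntegrableOn q I :=
    ((Lp.memLp q).locallyIntegrable (by norm_num)).integrableOn_isCompact isCompact_Icc
      |>.mono_set Set.Ioc_subset_Icc_self
  -- `(2πξ)² - t = (2π)² (ξ + ξ₀) (ξ - ξ₀) ≤ K (ξ - ξ₀)` on the interval.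
  set K : ℝ := (2 * Real.pi) ^ 2 * (2 * ξ₀ + c) with hK
  have hinv : IntegrableOn (fun ξ => (ξ - ξ₀)⁻¹) I := by
    refine (hint.norm.const_mul K).mono' (by fun_prop) ?_
    rw [ae_restrict_iff' hIm]
    filter_upwards [h3] with ξ e1 hξ
    have hpos : 0 < ξ - ξ₀ := sub_pos.2 hξ.1
    have e2 := congrArg norm (e1 hξ)
    rw [norm_mul, norm_one, ← Complex.ofReal_sub, Complex.norm_real, Real.norm_eq_abs] at e2
    have e3 : symbol ξ - t = (2 * Real.pi) ^ 2 * (ξ + ξ₀) * (ξ - ξ₀) := by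
      rw [← hsym, symbol, symbol]; ring
    have e4 : 0 ≤ (2 * Real.pi) ^ 2 * (ξ + ξ₀) := by
      have : 0 ≤ ξ + ξ₀ := by linarith
      positivity
    rw [e3, abs_of_nonneg (mul_nonneg e4 hpos.le)] at e2
    rw [Real.norm_eq_abs, abs_of_pos (inv_pos.2 hpos), inv_le_iff_one_le_mul₀ hpos, ← e2]
    have e5 : (2 * Real.pi) ^ 2 * (ξ + ξ₀) ≤ K :=
      mul_le_mul_of_nonneg_left (by linarith [hξ.2]) (by positivity)
    have := mul_le_mul_of_nonneg_right e5 (mul_nonneg hpos.le (norm_nonneg (q ξ)))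
    linarith
  have : IntervalIntegrable (fun ξ => (ξ - ξ₀)⁻¹) volume ξ₀ (ξ₀ + c) :=
    (intervalIntegrable_iff_integrableOn_Ioc_of_le (by linarith)).2 hinv
  rw [intervalIntegrable_sub_inv_iff] at this
  rcases this with h | h
  · linarith
  · exact h Set.left_mem_uIcc

/-! ### The resolvent set -/

theorem exists_forall_norm_resolvent_symbol_le {z : ℂ} {ρ : ℝ →ᵇ ℂ}
    (hρ : ∀ ξ, ρ ξ = ((symbol ξ : ℂ) - z)⁻¹) {ε : ℝ} (hε : 0 < ε) :
    ∃ M : ℝ, 0 < M ∧ ∀ ξ, M ≤ |ξ| → ‖ρ ξ‖ ≤ ε := by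
  refine ⟨ε⁻¹ + ‖z‖ + 1, by positivity, fun ξ hξ => ?_⟩
  have hε' : 0 < ε⁻¹ := inv_pos.2 hε
  have h1 : |ξ| ≤ symbol ξ := by
    have e : symbol ξ = (2 * Real.pi) ^ 2 * |ξ| ^ 2 := by rw [symbol, sq_abs]; ring
    have hξ1 : 1 ≤ |ξ| := by linarith [norm_nonneg z]
    have hpi : 1 ≤ (2 * Real.pi) ^ 2 := one_le_pow₀ (by linarith [Real.pi_gt_three])
    rw [e]
    nlinarith
  have h2 := norm_sub_norm_le (symbol ξ : ℂ) z
  rw [Complex.norm_real, Real.norm_eq_abs, abs_of_nonneg (symbol_nonneg _)] at h2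
  rw [hρ, norm_inv]
  exact inv_le_of_inv_le₀ hε (by linarith)

/-- There is a bounded weight `w` with bounded inverse `v` whose decrease along every translation by
`kc`, `k ≥ 1`, compensates the size of `ρ`: it decays exponentially on a long interval and is
constant outside, where `ρ` is small. -/
theorem exists_weight {z : ℂ} {ρ : ℝ →ᵇ ℂ} (hρ : ∀ ξ, ρ ξ = ((symbol ξ : ℂ) - z)⁻¹) {c : ℝ}
    (hc : 0 < c) {ε : ℝ} (hε : 0 < ε) :
    ∃ w v : ℝ →ᵇ ℂ, (∀ ξ, w ξ * v ξ = 1) ∧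
      ∀ (k : ℕ+) (ξ : ℝ), ‖w (ξ + k * c) * (ρ ξ * v ξ)‖ ≤ ε := by
  obtain ⟨M, hM, hρM⟩ := exists_forall_norm_resolvent_symbol_le hρ hε
  set D := ‖ρ‖ with hD
  obtain ⟨s, hs, hsD⟩ : ∃ s : ℝ, 0 < s ∧ D * Real.exp (-(s * c)) ≤ ε := by
    have hlim : Tendsto (fun s : ℝ => D * Real.exp (-(s * c))) atTop (𝓝 (D * 0)) :=
      (Real.tendsto_exp_neg_atTop_nhds_zero.comp
        (tendsto_id.atTop_mul_const hc)).const_mul D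
    rw [mul_zero] at hlim
    obtain ⟨s, h1, h2⟩ := ((hlim.eventually (Iic_mem_nhds hε)).and (eventually_gt_atTop 0)).exists
    exact ⟨s, h2, h1⟩
  set θ : ℝ → ℝ := fun ξ => max (-M) (min ξ (M + c)) with hθ
  have hθc : Continuous θ := by fun_prop
  have hθm : Monotone θ := fun x y hxy => max_le_max le_rfl (min_le_min hxy le_rfl)
  have hθb : ∀ ξ, |θ ξ| ≤ M + c := fun ξ => by
    rw [abs_le]
    exact ⟨le_trans (by linarith) (le_max_left _ _), max_le (by linarith) (min_le_right _ _)⟩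
  have hbd : ∀ (r : ℝ), |r| ≤ s → ∀ ξ, ‖((Real.exp (r * θ ξ) : ℝ) : ℂ)‖ ≤
      Real.exp (s * (M + c)) := fun r hr ξ => by
    rw [Complex.norm_real, Real.norm_eq_abs, Real.abs_exp, Real.exp_le_exp]
    refine (le_abs_self _).trans ?_
    rw [abs_mul]
    exact mul_le_mul hr (hθb ξ) (abs_nonneg _) hs.le
  refine ⟨BoundedContinuousFunction.ofNormedAddCommGroup
      (fun ξ => ((Real.exp (-s * θ ξ) : ℝ) : ℂ)) (by fun_prop) _
      (hbd (-s) (by rw [abs_neg, abs_of_pos hs])),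
    BoundedContinuousFunction.ofNormedAddCommGroup
      (fun ξ => ((Real.exp (s * θ ξ) : ℝ) : ℂ)) (by fun_prop) _
      (hbd s (abs_of_pos hs).le), fun ξ => ?_, fun k ξ => ?_⟩
  · simp only [BoundedContinuousFunction.coe_ofNormedAddCommGroup]
    rw [← Complex.ofReal_mul, ← Real.exp_add, neg_mul, neg_add_cancel, Real.exp_zero,
      Complex.ofReal_one]
  · simp only [BoundedContinuousFunction.coe_ofNormedAddCommGroup]
    have e : ‖((Real.exp (-s * θ (ξ + k * c)) : ℝ) : ℂ) *
        (ρ ξ * ((Real.exp (s * θ ξ) : ℝ) : ℂ))‖ =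
        ‖ρ ξ‖ * Real.exp (-(s * (θ (ξ + k * c) - θ ξ))) := by
      rw [norm_mul, norm_mul, Complex.norm_real, Complex.norm_real, Real.norm_eq_abs,
        Real.norm_eq_abs, Real.abs_exp, Real.abs_exp, mul_left_comm, ← Real.exp_add]
      congr 2
      ring
    rw [e]
    have hk : (1 : ℝ) ≤ k := Nat.one_le_cast.2 k.pos
    have hkc : c ≤ k * c := le_mul_of_one_le_left hc.le hk
    rcases le_or_gt M |ξ| with h | h
    · have : 0 ≤ θ (ξ + k * c) - θ ξ := sub_nonneg.2 (hθm (by linarith))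
      have h1 : Real.exp (-(s * (θ (ξ + k * c) - θ ξ))) ≤ 1 := by
        rw [Real.exp_le_one_iff, neg_nonpos]
        positivity
      exact (mul_le_of_le_one_right (norm_nonneg _) h1).trans (hρM ξ h)
    · obtain ⟨h1, h2⟩ := abs_lt.1 h
      have e1 : θ ξ = ξ := by
        simp only [hθ]
        rw [min_eq_left (by linarith), max_eq_right h1.le]
      have e2 : θ (ξ + c) = ξ + c := by
        simp only [hθ]
        rw [min_eq_left (by linarith), max_eq_right (by linarith)]
      have e3 : c ≤ θ (ξ + k * c) - θ ξ := by
        have := hθm (show ξ + c ≤ ξ + k * c by linarith)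
        linarith
      have e4 : Real.exp (-(s * (θ (ξ + k * c) - θ ξ))) ≤ Real.exp (-(s * c)) := by
        rw [Real.exp_le_exp, neg_le_neg_iff]
        exact mul_le_mul_of_nonneg_left e3 hs.le
      exact (mul_le_mul (ρ.norm_coe_le_norm ξ) e4 (Real.exp_pos _).le (norm_nonneg _)).trans hsD

/-- `1 + (∑ a_k T_{kc}) ρ` is invertible, because the second summand becomes a strict contraction
after conjugation with a suitable weight. -/
theorem isUnit_one_add_shiftSum_mul {a : ℕ+ → ℂ} (ha : Summable fun k => ‖a k‖) {c : ℝ}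
    (hc : 0 < c) {z : ℂ} {ρ : ℝ →ᵇ ℂ} (hρ : ∀ ξ, ρ ξ = ((symbol ξ : ℂ) - z)⁻¹) :
    IsUnit (1 + shiftSum a c * mulCLM ρ) := by
  set A := ∑' k, ‖a k‖ with hA
  have hA0 : 0 ≤ A := tsum_nonneg fun k => norm_nonneg _
  set ε : ℝ := (A + 1)⁻¹ with hε
  have hε0 : 0 < ε := by positivity
  obtain ⟨w, v, hwv, hb⟩ := exists_weight hρ hc hε0
  have hwv1 : mulCLM w * mulCLM v = 1 := by
    ext1 f
    refine (mulCLM_mulCLM w v f).trans ?_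
    rw [show w * v = 1 from BoundedContinuousFunction.ext hwv, mulCLM_one]
  have hvw1 : mulCLM v * mulCLM w = 1 := by
    ext1 f
    refine (mulCLM_mulCLM v w f).trans ?_
    rw [mul_comm, show w * v = 1 from BoundedContinuousFunction.ext hwv, mulCLM_one]
  -- The conjugate of `(∑ a_k T_{kc}) ρ` with the weight, of norm at most `A / (A + 1)`.
  set X : L2 →L[ℂ] L2 := mulCLM w * shiftSum a c * mulCLM ρ * mulCLM v with hX
  have hterm : ∀ (k : ℕ+) (g : L2),
      ‖mulCLM w (translate (k * c) (mulCLM ρ (mulCLM v g)))‖ ≤ ε * ‖g‖ := by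
    intro k g
    rw [← (translate (k * c)).norm_map g]
    refine Lp.norm_le_mul_norm_of_ae_le_mul ?_
    filter_upwards [coeFn_mulCLM w (translate (k * c) (mulCLM ρ (mulCLM v g))),
      coeFn_translate (k * c) (mulCLM ρ (mulCLM v g)), coeFn_translate (k * c) g,
      ae_comp_sub (coeFn_mulCLM ρ (mulCLM v g)) (k * c),
      ae_comp_sub (coeFn_mulCLM v g) (k * c)] with ξ h1 h2 h3 h4 h5
    rw [h1, h2, h3, h4, h5, ← mul_assoc, ← mul_assoc, norm_mul]
    refine mul_le_mul_of_nonneg_right ?_ (norm_nonneg _)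
    have := hb k (ξ - k * c)
    rwa [sub_add_cancel, ← mul_assoc] at this
  have hXn : ‖X‖ ≤ A * ε := by
    refine ContinuousLinearMap.opNorm_le_bound _ (by positivity) fun g => ?_
    have hsum := ((hasSum_shiftSum ha c).mapL
      (ContinuousLinearMap.apply ℂ L2 (mulCLM ρ (mulCLM v g)))).mapL (mulCLM w)
    have hbound := (ha.hasSum.mul_right (ε * ‖g‖))
    have := tsum_of_norm_bounded hbound fun k : ℕ+ =>
      (show ‖mulCLM w (ContinuousLinearMap.apply ℂ L2 (mulCLM ρ (mulCLM v g))
        (a k • (translate (k * c)).toContinuousLinearMap))‖ ≤ ‖a k‖ * (ε * ‖g‖) by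
        rw [ContinuousLinearMap.apply_apply, _root_.smul_apply, map_smul, norm_smul]
        exact mul_le_mul_of_nonneg_left (hterm k g) (norm_nonneg _))
    rw [hsum.tsum_eq, ← mul_assoc] at this
    exact this
  have hX1 : ‖-X‖ < 1 := by
    rw [norm_neg]
    refine hXn.trans_lt ?_
    rw [hε, ← div_eq_mul_inv, div_lt_one (by positivity)]
    linarith
  have hu : IsUnit (1 + X) := by
    have := isUnit_one_sub_of_norm_lt_one hX1
    rwa [sub_neg_eq_add] at this
  have hv : IsUnit (mulCLM v) := ⟨⟨mulCLM v, mulCLM w, hvw1, hwv1⟩, rfl⟩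
  have hw : IsUnit (mulCLM w) := ⟨⟨mulCLM w, mulCLM v, hwv1, hvw1⟩, rfl⟩
  have e : 1 + shiftSum a c * mulCLM ρ = mulCLM v * (1 + X) * mulCLM w := by
    have : mulCLM v * (1 + X) * mulCLM w = mulCLM v * mulCLM w +
        (mulCLM v * mulCLM w) * (shiftSum a c * mulCLM ρ) * (mulCLM v * mulCLM w) := by
      rw [hX]; noncomm_ring
    rw [this, hvw1, one_mul, mul_one]
  rw [e]
  exact (hv.mul hu).mul hw

theorem mem_resolventSet {a : ℕ+ → ℂ} (ha : Summable fun k => ‖a k‖) {z : ℂ}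
    (hz : ¬ ∃ t : ℝ, 0 ≤ t ∧ z = t) : z ∈ resolventSet (hillOperator (potential a ha)) := by
  set c : ℝ := (2 * Real.pi)⁻¹ with hc
  obtain ⟨ρ, hρ⟩ := exists_resolvent_symbol hz
  obtain ⟨B, hB⟩ := isUnit_one_add_shiftSum_mul ha (c := c) (by positivity) hρ
  have hBi : ∀ g : L2, (↑B⁻¹ : L2 →L[ℂ] L2) g +
      shiftSum a c (mulCLM ρ ((↑B⁻¹ : L2 →L[ℂ] L2) g)) = g := by
    intro g
    have := congrArg (fun X : L2 →L[ℂ] L2 => X g) B.mul_inv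
    rw [hB] at this
    exact this
  have hBi' : ∀ p : L2, (↑B⁻¹ : L2 →L[ℂ] L2) (p + shiftSum a c (mulCLM ρ p)) = p := by
    intro p
    have := congrArg (fun X : L2 →L[ℂ] L2 => X p) B.inv_mul
    rw [hB] at this
    exact this
  let U := (Lp.fourierTransformₗᵢ ℝ ℂ).toContinuousLinearEquiv
  refine ⟨(U.symm : L2 →L[ℂ] L2) ∘L mulCLM ρ ∘L (↑B⁻¹ : L2 →L[ℂ] L2) ∘L (U : L2 →L[ℂ] L2),
    fun g => ?_, fun f => ?_⟩
  · set p : L2 := (↑B⁻¹ : L2 →L[ℂ] L2) (𝓕 g) with hp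
    refine ⟨fourierInv_mulCLM_mem_W22 hz hρ p, (Lp.fourierTransformₗᵢ ℝ ℂ).injective ?_⟩
    have h1 := fourier_hillOperator_sub ha z
      ⟨𝓕⁻ (mulCLM ρ p), fourierInv_mulCLM_mem_W22 hz hρ p⟩
    simp only [fourier_fourierInv_eq] at h1
    refine Lp.ext (h1.trans ?_)
    change _ =ᵐ[volume] ((𝓕 g : L2) : ℝ → ℂ)
    rw [← hBi (𝓕 g), ← hp]
    filter_upwards [Lp.coeFn_add p (shiftSum a c (mulCLM ρ p)), coeFn_mulCLM ρ p] with ξ e1 e2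
    rw [e1, Pi.add_apply, e2, hρ, mul_inv_cancel_left₀ (symbol_sub_ne hz ξ)]
  · -- With `p = ((2πξ)² - z) q` one has `q = ρ p` and `r = (1 + (∑ a_k T_{kc}) ρ) p`.
    set q : L2 := 𝓕 (f : L2) with hq
    set r : L2 := 𝓕 (hillOperator (potential a ha) f - z • (f : L2)) with hr
    set p : L2 := r - shiftSum a c q with hp
    have h1 : mulCLM ρ p = q := by
      refine Lp.ext ?_
      filter_upwards [coeFn_mulCLM ρ p, Lp.coeFn_sub r (shiftSum a c q),
        fourier_hillOperator_sub ha z f] with ξ e1 e2 e3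
      rw [← hr, ← hq, ← hc] at e3
      rw [e1, e2, Pi.sub_apply, e3, add_sub_cancel_right, hρ,
        inv_mul_cancel_left₀ (symbol_sub_ne hz ξ)]
    have h2 : (↑B⁻¹ : L2 →L[ℂ] L2) r = p := by
      rw [← hBi' p, h1, hp, sub_add_cancel]
    change 𝓕⁻ (mulCLM ρ ((↑B⁻¹ : L2 →L[ℂ] L2) r)) = (f : L2)
    rw [h2, h1, hq, fourierInv_fourier_eq]

theorem spectrum_hillOperator {a : ℕ+ → ℂ} (ha : Summable fun k => ‖a k‖) :
    spectrum (hillOperator (potential a ha)) = {z : ℂ | ∃ t : ℝ, 0 ≤ t ∧ z = (t : ℂ)} := by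
  ext z
  refine ⟨fun hz => by_contra fun h => hz (mem_resolventSet ha h), ?_⟩
  rintro ⟨t, ht, rfl⟩ ⟨R, hR, -⟩
  exact not_surjective_hillOperator_sub ha ht fun g => ⟨⟨R g, (hR g).1⟩, (hR g).2⟩

end Hill

theorem corollary1p3 (a : ℕ+ → ℂ) (ha : Summable fun k => ‖a k‖) :
    Hill.HasPurelyContinuousSpectrum (Hill.hillOperator (Hill.potential a ha)) ∧
      Hill.spectrum (Hill.hillOperator (Hill.potential a ha)) =
        {z : ℂ | ∃ t : ℝ, 0 ≤ t ∧ z = (t : ℂ)} :=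
  ⟨Set.Subset.antisymm (fun _ hz => hz.1) fun z hz => ⟨hz,
    Hill.injective_hillOperator_sub ha z, Hill.denseRange_hillOperator_sub ha z⟩,
    Hill.spectrum_hillOperator ha⟩
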